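/- \textbf{Theorem (Multi-ratio description of generalized Clifford configurations).} Identify $\mathbb{R}^4$ with the quaternions $\mathbb{H}$. Label the vertices of an octahedron by the two-element subsets $ik=ki$ of $\{1,2,3,4\}$, opposite vertices having complementary labels; its eight triangular faces are then the triples $\{ik,il,im\}$ and $\{ik,il,kl\}$ with distinct indices. An \emph{octahedral point-circle configuration} consists of six points $\Phi_{ik}\in\mathbb{H}$ and eight circles (straight lines being admitted as degenerate circles), one for each face, such that $\Phi_{ik}$ lies on the circle of a face if and only if $ik$ is a vertex of that face. The circles are oriented so that the induced orientations of the faces of the octahedron are all the same when viewed from outside. The angle of two oriented circles at a common point is the angle between their tangent vectors (of the same orientation) at that point. Circles through different points \emph{correspond} according to the equivalence relation on pairs (circle $S$, point $P$ of the configuration on $S$) which is generated by: (i) if the distinct circles $S_1,S_2$ share two points $P_1\neq P_2$ of the configuration, then $(S_1;P_1)\leftrightarrow(S_2;P_2)$ and $(S_2;P_1)\leftrightarrow(S_1;P_2)$; (ii) $(S;P)\leftrightarrow(S^*;P^*)$, where $S^*$ and $P^*$ belong to the opposite face and the opposite vertex. The configuration is a \emph{generalized Clifford configuration} if for all points $P,P'$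 of the configuration, all circles $S,T$ through $P$ and the corresponding circles $S',T'$ through $P'$, the angle of $S,T$ at $P$ equals the angle of $S',T'$ at $P'$. For six quaternions with $P_i\ne P_{i+1}$ (indices modulo $6$) put $$M(P_1,\dots,P_6)=(P_1-P_2)(P_2-P_3)^{-1}(P_3-P_4)(P_4-P_5)^{-1}(P_5-P_6)(P_6-P_1)^{-1},$$ $$\tilde M(P_1,\dots,P_6)=(P_1-P_6)^{-1}(P_6-P_5)(P_5-P_4)^{-1}(P_4-P_3)(P_3-P_2)^{-1}(P_2-P_1).$$ The points of every generalized Clifford configuration satisfy $$M(\Phi_{14},\Phi_{12},\Phi_{24},\Phi_{23},\Phi_{34},\Phi_{13})=-1\qquad\text{or}\qquad \tilde M(\Phi_{14},\Phi_{12},\Phi_{24},\Phi_{23},\Phi_{34},\Phi_{13})=-1$$ (possibly both). Conversely, every octahedral point-circle configuration whose six points $\Phi_{ik}$ satisfy at least one of these two conditions is a generalized Clifford configuration. -/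

import Mathlib

open scoped Quaternion

/-! ## The combinatorial octahedron -/

/-- The six vertices `(ik) = (ki)`, `i ≠ k ∈ {1, 2, 3, 4}`, of the octahedron. -/
inductive OctVertex where
  | v12 | v13 | v14 | v23 | v24 | v34

/-- The eight faces of the octahedron: `s i` is the face with the vertices `(ik)`, `k ≠ i`, and
`s ikl` is the face with the vertices `(ik)`, `(kl)`, `(il)`. -/
inductive OctFace where
  | s1 | s2 | s3 | s4 | s123 | s124 | s134 | s234

namespace OctVertex

/-- The opposite vertex: the one with the complementary pair of indices. -/
def opp : OctVertex → OctVertex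
  | v12 => v34
  | v13 => v24
  | v14 => v23
  | v23 => v14
  | v24 => v13
  | v34 => v12

end OctVertex

namespace OctFace

open OctVertex

/-- The three vertices of a face, in the cyclic order given by an orientation of the boundary of
the octahedron: every edge is traversed in opposite directions by its two faces, so all faces have
the same orientation when they are viewed from outside. -/
def vertex : OctFace → Fin 3 → OctVertex
  | s1 => ![v14, v12, v13]
  | s123 => ![v13, v12, v23]
  | s124 => ![v24, v12, v14]
  | s2 => ![v23, v12, v24]
  | s134 => ![v14, v13, v34]
  | s3 => ![v34, v13, v23]
  | s4 => ![v14, v34, v24]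
  | s234 => ![v24, v34, v23]

/-- `f.Has v`: the vertex `v` belongs to the face `f`. -/
def Has (f : OctFace) (v : OctVertex) : Prop := ∃ i : Fin 3, f.vertex i = v

/-- The opposite face: the one whose vertices are the opposites of the vertices of `f`. -/
def opp : OctFace → OctFace
  | s1 => s234
  | s2 => s134
  | s3 => s124
  | s4 => s123
  | s123 => s4
  | s124 => s3
  | s134 => s2
  | s234 => s1

/-- Every edge is traversed in opposite directions by the two faces that contain it: the next
vertex after `w` on one of them is `v` when the next vertex after `v` on the other is `w`. -/
theorem coherent (f : OctFace) (i : Fin 3) :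
    ∃ (g : OctFace) (j : Fin 3), g ≠ f ∧ g.vertex j = f.vertex (i + 1) ∧
      g.vertex (j + 1) = f.vertex i := by
  cases f <;> fin_cases i
  · exact ⟨s124, 1, by simp, rfl, rfl⟩
  · exact ⟨s123, 0, by simp, rfl, rfl⟩
  · exact ⟨s134, 0, by simp, rfl, rfl⟩
  · exact ⟨s123, 1, by simp, rfl, rfl⟩
  · exact ⟨s124, 0, by simp, rfl, rfl⟩
  · exact ⟨s234, 2, by simp, rfl, rfl⟩
  · exact ⟨s134, 1, by simp, rfl, rfl⟩
  · exact ⟨s123, 2, by simp, rfl, rfl⟩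
  · exact ⟨s234, 1, by simp, rfl, rfl⟩
  · exact ⟨s134, 2, by simp, rfl, rfl⟩
  · exact ⟨s234, 0, by simp, rfl, rfl⟩
  · exact ⟨s124, 2, by simp, rfl, rfl⟩
  · exact ⟨s1, 1, by simp, rfl, rfl⟩
  · exact ⟨s2, 0, by simp, rfl, rfl⟩
  · exact ⟨s3, 1, by simp, rfl, rfl⟩
  · exact ⟨s2, 1, by simp, rfl, rfl⟩
  · exact ⟨s1, 0, by simp, rfl, rfl⟩
  · exact ⟨s4, 2, by simp, rfl, rfl⟩
  · exact ⟨s1, 2, by simp, rfl, rfl⟩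
  · exact ⟨s3, 0, by simp, rfl, rfl⟩
  · exact ⟨s4, 0, by simp, rfl, rfl⟩
  · exact ⟨s4, 1, by simp, rfl, rfl⟩
  · exact ⟨s3, 2, by simp, rfl, rfl⟩
  · exact ⟨s2, 2, by simp, rfl, rfl⟩

end OctFace

/-- The correspondence between (face, vertex) pairs: the equivalence relation generated by
`(S₁, S₂; P₁, P₂) ↔ (S₂, S₁; P₂, P₁)`, where `S₁ ≠ S₂` share the vertices `P₁ ≠ P₂`, and
`(S; P) ↔ (S*; P*)`, where the star denotes opposites. -/
inductive OctCorresponds : OctFace → OctVertex → OctFace → OctVertex → Prop where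
  | edge (f g : OctFace) (v w : OctVertex) (hfg : f ≠ g) (hvw : v ≠ w)
      (hfv : f.Has v) (hfw : f.Has w) (hgv : g.Has v) (hgw : g.Has w) : OctCorresponds f v g w
  | opposite (f : OctFace) (v : OctVertex) (hfv : f.Has v) : OctCorresponds f v f.opp v.opp
  | refl (f : OctFace) (v : OctVertex) (hfv : f.Has v) : OctCorresponds f v f v
  | symm {f g : OctFace} {v w : OctVertex} :
      OctCorresponds f v g w → OctCorresponds g w f v
  | trans {f g h : OctFace} {u v w : OctVertex} :
      OctCorresponds f u g v → OctCorresponds g v h w → OctCorresponds f u h w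

/-! ## Oriented circles in the four-dimensional Euclidean space of quaternions -/

/-- An oriented circle of the conformal geometry of `ℝ⁴ ≅ ℍ`. It is either a circle with centre
`o` and radius `r` in the plane through `o` spanned by the orthonormal vectors `u`, `w` (traversed
from `u` towards `w`), or a straight line through `p` with the unit direction vector `u`. -/
inductive OrientedCircle where
  | circle (o u w : ℍ[ℝ]) (r : ℝ) (hr : 0 < r) (hu : ‖u‖ = 1) (hw : ‖w‖ = 1)
      (huw : inner ℝ u w = 0) : OrientedCircle
  | line (p u : ℍ[ℝ]) (hu : ‖u‖ = 1) : OrientedCircle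

namespace OrientedCircle

/-- The standard parametrization of an oriented circle, compatible with the orientation. -/
noncomputable def curve : OrientedCircle → ℝ → ℍ[ℝ]
  | circle o u w r _ _ _ _, t => o + (r * Real.cos t) • u + (r * Real.sin t) • w
  | line p u _, t => p + t • u

/-- The points of an oriented circle. -/
def carrier (C : OrientedCircle) : Set ℍ[ℝ] := Set.range C.curve

/-- The tangent vector, of the same orientation as the circle, at the point `x` of the circle. -/
noncomputable def tangent : OrientedCircle → ℍ[ℝ] → ℍ[ℝ]
  | circle o u w _ _ _ _ _, x => (inner ℝ (x - o) u) • w - (inner ℝ (x - o) w) • u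
  | line _ u _, _ => u

/-- `tangent` is the velocity of the parametrization. -/
theorem hasDerivAt_curve (C : OrientedCircle) (t : ℝ) :
    HasDerivAt C.curve (C.tangent (C.curve t)) t := by
  cases C with
  | circle o u w r hr hu hw huw =>
    have hwu : inner ℝ w u = 0 := by rw [real_inner_comm]; exact huw
    have e : (circle o u w r hr hu hw huw).tangent ((circle o u w r hr hu hw huw).curve t)
        = (r * -Real.sin t) • u + (r * Real.cos t) • w := by
      have h : o + (r * Real.cos t) • u + (r * Real.sin t) • w - o
          = (r * Real.cos t) • u + (r * Real.sin t) • w := by abel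
      simp only [tangent, curve, h, inner_add_left, real_inner_smul_left, huw, hwu,
        real_inner_self_eq_norm_sq, hu, hw]
      module
    rw [e]
    exact (((Real.hasDerivAt_cos t).const_mul r).smul_const u |>.const_add o).add
      (((Real.hasDerivAt_sin t).const_mul r).smul_const w)
  | line p u hu =>
    have h := ((hasDerivAt_id t).smul_const u).const_add p
    rw [one_smul] at h
    exact h

/-- The oriented circle `C` passes through `x`, `y`, `z` in this cyclic order. (A line is closed
up by the point at infinity, hence the three cases.) -/
def Traverses : OrientedCircle → ℍ[ℝ] → ℍ[ℝ] → ℍ[ℝ] → Prop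
  | C@(circle _ _ _ _ _ _ _ _), x, y, z =>
      ∃ a b c : ℝ, C.curve a = x ∧ C.curve b = y ∧ C.curve c = z ∧
        a < b ∧ b < c ∧ c < a + 2 * Real.pi
  | C@(line _ _ _), x, y, z =>
      ∃ a b c : ℝ, C.curve a = x ∧ C.curve b = y ∧ C.curve c = z ∧
        ((a < b ∧ b < c) ∨ (b < c ∧ c < a) ∨ (c < a ∧ a < b))

/-- The angle made by two oriented circles at a common point `x`: the angle, in `[0, π]`, between
their tangent vectors at `x`. -/
noncomputable def angleAt (x : ℍ[ℝ]) (C D : OrientedCircle) : ℝ :=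
  InnerProductGeometry.angle (C.tangent x) (D.tangent x)

end OrientedCircle

/-! ## Octahedral point-circle configurations -/

/-- An octahedral point-circle configuration in `ℝ⁴ ≅ ℍ`: six points and eight circles whose
incidences are exactly those between the vertices and the faces of an octahedron. The circles are
oriented so that the corresponding orientations of the faces of the octahedron agree. -/
structure OctahedralConfiguration where
  /-- The point attached to a vertex. -/
  point : OctVertex → ℍ[ℝ]
  /-- The oriented circle attached to a face. -/
  circle : OctFace → OrientedCircle
  /-- The incidence relation is that of the octahedron. -/
  mem_carrier_iff : ∀ (v : OctVertex) (f : OctFace), point v ∈ (circle f).carrier ↔ f.Has v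
  /-- The orientation convention. -/
  traverses : ∀ f : OctFace, (circle f).Traverses
    (point (f.vertex 0)) (point (f.vertex 1)) (point (f.vertex 2))

/-- An octahedral point-circle configuration is a generalized Clifford configuration if the angles
made by pairs of corresponding oriented circles are the same at all its points. -/
def OctahedralConfiguration.IsGeneralizedClifford (K : OctahedralConfiguration) : Prop :=
  ∀ (v w : OctVertex) (f g f' g' : OctFace),
    OctCorresponds f v f' w → OctCorresponds g v g' w →
      OrientedCircle.angleAt (K.point v) (K.circle f) (K.circle g) =
        OrientedCircle.angleAt (K.point w) (K.circle f') (K.circle g')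

/-! ## Quaternionic multi-ratios -/

/-- The right multi-ratio `M` of six quaternions. -/
noncomputable def rightMultiRatio (p₁ p₂ p₃ p₄ p₅ p₆ : ℍ[ℝ]) : ℍ[ℝ] :=
  (p₁ - p₂) * (p₂ - p₃)⁻¹ * (p₃ - p₄) * (p₄ - p₅)⁻¹ * (p₅ - p₆) * (p₆ - p₁)⁻¹

/-- The left multi-ratio of six quaternions. -/
noncomputable def leftMultiRatio (p₁ p₂ p₃ p₄ p₅ p₆ : ℍ[ℝ]) : ℍ[ℝ] :=
  (p₁ - p₆)⁻¹ * (p₆ - p₅) * (p₅ - p₄)⁻¹ * (p₄ - p₃) * (p₃ - p₂)⁻¹ * (p₂ - p₁)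

/-!
The inversion at a vertex of an octahedral configuration turns the four circles through it into the
lines along the sides of a closed quadrilateral, and the tangent vectors at the vertex become the
directions of these sides. Number the vertices as `P 0, …, P 5` in the order of the multi-ratios,
invert at `P 0`, move the image of `P 3` to the origin, and let `x`, `a`, `b`, `y` be the images of
`P 1`, `P 2`, `P 4`, `P 5`. Then `M = -1` says that `a⁻¹ * x = b⁻¹ * y`, and the other condition
says that `x * a⁻¹ = y * b⁻¹`: the vectors `x`, `y` arise from `a`, `b` by the same right or left
multiplication.

If `x = a * k` and `y = b * k`, the tangent vectors at `P 0` and `P 1` are products of `a`, `b`,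
`b - a`, `k`, `1 - k` and their inverses, and their angles agree after the cancellation of common
outer factors. The symmetries of `M` carry this to the other vertices, and conjugation exchanges
the two conditions.

Conversely, the linear relation between the four sides of a quadrilateral depends only on the angles
between them, so equal angles at `P 0`, `P 1` and `P 5` fix the ratios of lengths too: `x`, `y`,
`x - y` arise from `a`, `b`, `a - b` by the same stretch and turn by the same angle. This is only
possible for a right or a left multiplication.
-/

/-! ## Inversions and angles -/

section DivisionRing

variable {D : Type*} [DivisionRing D] {x y z : D}

/-- The difference of the images of `y` and `z` under the inversion `w ↦ (w - x)⁻¹` at `x`. In the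
quaternions it is conjugate to a tangent vector at `x` of the circle through `x`, `y`, `z` in this
cyclic order. -/
def invDiff (x y z : D) : D := (y - x)⁻¹ - (z - x)⁻¹

theorem invDiff_swap (x y z : D) : invDiff x z y = -invDiff x y z := (neg_sub _ _).symm

theorem invDiff_add_invDiff (x y z w : D) : invDiff x y z + invDiff x z w = invDiff x y w :=
  sub_add_sub_cancel _ _ _

theorem invDiff_eq_zero_iff : invDiff x y z = 0 ↔ y = z := by
  rw [invDiff, sub_eq_zero, inv_inj, sub_left_inj]

theorem invDiff_sub_sub (x y z o : D) : invDiff (x - o) (y - o) (z - o) = invDiff x y z := by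
  simp only [invDiff, sub_sub_sub_cancel_right]

theorem invDiff_eq_mul (hy : y ≠ x) (hz : z ≠ x) :
    invDiff x y z = (y - x)⁻¹ * (z - y) * (z - x)⁻¹ := by
  rw [invDiff, inv_sub_inv' (sub_ne_zero.2 hy) (sub_ne_zero.2 hz), sub_sub_sub_cancel_right]

theorem invDiff_eq_mul_rev (hy : y ≠ x) (hz : z ≠ x) :
    invDiff x y z = (z - x)⁻¹ * (z - y) * (y - x)⁻¹ := by
  rw [← neg_neg (invDiff x y z), ← invDiff_swap, invDiff_eq_mul hz hy, ← neg_sub z y, mul_neg,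
    neg_mul, neg_neg]

theorem invDiff_zero_left (hx : x ≠ 0) (hy : y ≠ 0) (hxy : y ≠ x) :
    invDiff x 0 y = x⁻¹ * (y⁻¹ - x⁻¹)⁻¹ * x⁻¹ := by
  rw [invDiff_eq_mul_rev hx.symm hxy, inv_sub_inv' hy hx, mul_inv_rev, mul_inv_rev, inv_inv,
    inv_inv, inv_mul_cancel_left₀ hx, ← neg_sub x y, sub_zero, zero_sub, inv_neg, inv_neg, mul_neg,
    neg_mul, neg_mul, neg_neg]

theorem invDiff_inv (hx : x ≠ 0) (hy : y ≠ 0) (hz : z ≠ 0) (hxy : y ≠ x) (hxz : z ≠ x) :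
    x⁻¹ * invDiff x⁻¹ y⁻¹ z⁻¹ * x⁻¹ = -invDiff x y z := by
  rw [invDiff, mul_sub, sub_mul, ← invDiff_zero_left hx hy hxy, ← invDiff_zero_left hx hz hxz,
    ← invDiff_add_invDiff x 0 y z, sub_add_cancel_left]

end DivisionRing

section Angle

open InnerProductGeometry

section NormedDivisionRing

variable {D : Type*} [NormedDivisionRing D] [InnerProductSpace ℝ D] {c : D}

theorem inner_mul_mul_left (c x y : D) : inner ℝ (c * x) (c * y) = ‖c‖ ^ 2 * inner ℝ x y := by
  simp only [real_inner_eq_norm_mul_self_add_norm_mul_self_sub_norm_sub_mul_self_div_two,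
    ← mul_sub, norm_mul]
  ring

theorem inner_mul_mul_right (x y c : D) : inner ℝ (x * c) (y * c) = ‖c‖ ^ 2 * inner ℝ x y := by
  simp only [real_inner_eq_norm_mul_self_add_norm_mul_self_sub_norm_sub_mul_self_div_two,
    ← sub_mul, norm_mul]
  ring

theorem angle_mul_mul_left (hc : c ≠ 0) (x y : D) : angle (c * x) (c * y) = angle x y := by
  have h : ‖c‖ ^ 2 ≠ 0 := pow_ne_zero 2 (norm_ne_zero_iff.2 hc)
  rw [angle, angle, inner_mul_mul_left, norm_mul, norm_mul, mul_mul_mul_comm, ← sq,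
    mul_div_mul_left _ _ h]

theorem angle_mul_mul_right (hc : c ≠ 0) (x y : D) : angle (x * c) (y * c) = angle x y := by
  have h : ‖c‖ ^ 2 ≠ 0 := pow_ne_zero 2 (norm_ne_zero_iff.2 hc)
  rw [angle, angle, inner_mul_mul_right, norm_mul, norm_mul, mul_mul_mul_comm, ← sq,
    mul_comm _ (‖c‖ ^ 2), mul_div_mul_left _ _ h]

theorem angle_inv_inv (x y : D) : angle x⁻¹ y⁻¹ = angle x y := by
  rcases eq_or_ne x 0 with rfl | hx
  · rw [inv_zero, angle_zero_left, angle_zero_left]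
  rcases eq_or_ne y 0 with rfl | hy
  · rw [inv_zero, angle_zero_right, angle_zero_right]
  rw [← angle_mul_mul_left hx, ← angle_mul_mul_right hy, mul_inv_cancel₀ hx, one_mul,
    inv_mul_cancel_right₀ hy, angle_comm]

end NormedDivisionRing

theorem angle_star_star {E : Type*} [NormedAddCommGroup E] [InnerProductSpace ℝ E]
    [StarAddMonoid E] [NormedStarGroup E] (x y : E) : angle (star x) (star y) = angle x y := by
  rw [angle, angle, real_inner_eq_norm_mul_self_add_norm_mul_self_sub_norm_sub_mul_self_div_two,
    real_inner_eq_norm_mul_self_add_norm_mul_self_sub_norm_sub_mul_self_div_two, ← star_sub,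
    norm_star x, norm_star y, norm_star (x - y)]

theorem inner_normalize_normalize {V : Type*} [NormedAddCommGroup V] [InnerProductSpace ℝ V]
    (x y : V) :
    inner ℝ (NormedSpace.normalize x) (NormedSpace.normalize y) = Real.cos (angle x y) := by
  rw [cos_angle, NormedSpace.normalize, NormedSpace.normalize, real_inner_smul_left,
    real_inner_smul_right, div_eq_inv_mul, mul_inv, mul_assoc]

end Angle

/-- Two families of vectors, possibly of different spaces, make the same angles. -/
def SameAngles {ι V W : Type*} [NormedAddCommGroup V] [InnerProductSpace ℝ V]
    [NormedAddCommGroup W] [InnerProductSpace ℝ W] (f : ι → V) (g : ι → W) : Prop :=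
  ∀ i j, InnerProductGeometry.angle (f i) (f j) = InnerProductGeometry.angle (g i) (g j)

namespace SameAngles

open InnerProductGeometry NormedSpace

variable {ι κ U V W : Type*} [NormedAddCommGroup U] [InnerProductSpace ℝ U]
  [NormedAddCommGroup V] [InnerProductSpace ℝ V] [NormedAddCommGroup W] [InnerProductSpace ℝ W]
  {e : ι → U} {f : ι → V} {g : ι → W}

theorem symm (h : SameAngles f g) : SameAngles g f := fun i j => (h i j).symm

theorem trans (h : SameAngles e f) (h' : SameAngles f g) : SameAngles e g :=
  fun i j => (h i j).trans (h' i j)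

theorem comp (h : SameAngles f g) (σ : κ → ι) : SameAngles (f ∘ σ) (g ∘ σ) :=
  fun i j => h (σ i) (σ j)

theorem of_fin_four {f : Fin 4 → V} {g : Fin 4 → W} (hf : ∀ i, f i ≠ 0) (hg : ∀ i, g i ≠ 0)
    (h01 : angle (f 0) (f 1) = angle (g 0) (g 1)) (h02 : angle (f 0) (f 2) = angle (g 0) (g 2))
    (h03 : angle (f 0) (f 3) = angle (g 0) (g 3)) (h12 : angle (f 1) (f 2) = angle (g 1) (g 2))
    (h13 : angle (f 1) (f 3) = angle (g 1) (g 3)) (h23 : angle (f 2) (f 3) = angle (g 2) (g 3)) :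
    SameAngles f g := by
  have angle_lt : ∀ i j, i < j → angle (f i) (f j) = angle (g i) (g j) := by
    simp [Fin.forall_fin_succ, *]
  intro i j
  rcases lt_trichotomy i j with hij | rfl | hij
  · exact angle_lt i j hij
  · rw [angle_self (hf i), angle_self (hg i)]
  · rw [angle_comm, angle_lt j i hij, angle_comm]

theorem inner_normalize (h : SameAngles f g) (i j : ι) :
    inner ℝ (normalize (f i)) (normalize (f j)) = inner ℝ (normalize (g i)) (normalize (g j)) := by
  rw [inner_normalize_normalize, inner_normalize_normalize, h i j]

theorem sum_smul_normalize_eq_zero [Fintype ι] (h : SameAngles f g) {c : ι → ℝ}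
    (hf : ∑ i, c i • normalize (f i) = 0) : ∑ i, c i • normalize (g i) = 0 := by
  rw [← inner_self_eq_zero (𝕜 := ℝ)] at hf ⊢
  simpa only [sum_inner, inner_sum, real_inner_smul_left, real_inner_smul_right,
    h.inner_normalize] using hf

theorem norm_eq_mul_of_sum_eq_zero [Fintype ι] (h : SameAngles f g) {S : Finset ι}
    (hS : LinearIndepOn ℝ f (S : Set ι)) (hf : ∑ i, f i = 0) (hg : ∑ i, g i = 0) {s : ℝ}
    (hs : ∀ i ∉ S, ‖g i‖ = s * ‖f i‖) (i : ι) : ‖g i‖ = s * ‖f i‖ := by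
  have relation : ∑ j, (‖g j‖ - s * ‖f j‖) • normalize (f j) = 0 := by
    have : ∑ j, ‖g j‖ • normalize (f j) = 0 :=
      h.symm.sum_smul_normalize_eq_zero (by simpa using hg)
    simp only [sub_smul, mul_smul, norm_smul_normalize, Finset.sum_sub_distrib, ← Finset.smul_sum,
      this, hf, smul_zero, sub_zero]
  have relation_on : ∑ j ∈ S, ((‖g j‖ - s * ‖f j‖) * ‖f j‖⁻¹) • f j = 0 := by
    rw [← relation, ← Finset.sum_subset S.subset_univ fun j _ hj => by
      rw [hs j hj, sub_self, zero_smul]]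
    simp only [NormedSpace.normalize, mul_smul]
  by_contra hi
  have hiS : i ∈ S := not_imp_comm.1 (hs i) hi
  rcases mul_eq_zero.1 (linearIndepOn_finset_iff.1 hS _ relation_on i hiS) with h0 | h0
  · exact hi (sub_eq_zero.1 h0)
  · exact hS.ne_zero hiS (norm_eq_zero.1 (inv_eq_zero.1 h0))

end SameAngles

/-! ## Isoclinic similarities -/

section Isoclinic

open Quaternion

theorem eq_or_mul_eq_mul_of_re_mul_sub_eq_zero {R : Type*} [Field R] [LinearOrder R]
    [IsStrictOrderedRing R] {g k l : ℍ[R]} (hre : k.re = l.re) (hnorm : normSq k = normSq l)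
    (hg : (g * (k - l)).re = 0) (hgk : (g * k * (k - l)).re = 0) : k = l ∨ g * k = l * g := by
  rcases eq_or_ne k l with hkl | hkl
  · exact .inl hkl
  have star_sub_eq : star (k - l) = -(k - l) := star_eq_neg.2 (by rw [re_sub, hre, sub_self])
  have sub_mul_star : (k - l) * star k = l * (k - l) := by
    calc (k - l) * star k = l * star l - l * star k := by
          rw [sub_mul, self_mul_star, hnorm, ← self_mul_star]
      _ = l * (k - l) := by
          rw [← mul_sub, ← star_sub, ← neg_sub k l, star_neg, star_sub_eq, neg_neg]
  have mul_sub_eq : g * (k - l) = (k - l) * star g := by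
    rw [← star_eq_neg, star_mul, star_sub_eq, neg_mul, neg_inj] at hg
    exact hg.symm
  refine .inr (mul_right_cancel₀ (sub_ne_zero.2 hkl) ?_)
  rw [← star_eq_neg, star_mul, star_mul, star_sub_eq, neg_mul, neg_inj, ← mul_assoc,
    sub_mul_star, mul_assoc, ← mul_sub_eq, ← mul_assoc] at hgk
  exact hgk.symm

theorem eq_or_mul_eq_mul_of_inner_sub {g k l : ℍ[ℝ]} (hre : k.re = l.re)
    (hnorm : normSq k = normSq l) (hnorm_sub : normSq (g * k - l) = normSq k * normSq (g - 1))
    (hinner_sub : inner ℝ (g * k - l) (g - 1) = k.re * normSq (g - 1)) :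
    k = l ∨ g * k = l * g := by
  refine eq_or_mul_eq_mul_of_re_mul_sub_eq_zero hre hnorm ?_ ?_ <;>
  simp only [normSq_def', inner_def, re_mul, imI_mul, imJ_mul, imK_mul, re_sub, imI_sub, imJ_sub,
    imK_sub, re_star, imI_star, imJ_star, imK_star, re_one, imI_one, imJ_one, imK_one]
    at hnorm hnorm_sub hinner_sub ⊢
  · linear_combination (2 * g.re - 1) * hre - hinner_sub
  · linear_combination 2 * (g.re * k.re - g.imI * k.imI - g.imJ * k.imJ - g.imK * k.imK) * hre
      - hnorm_sub / 2 - hnorm / 2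

/-- Left and right multiplications are the two families of isoclinic similarities of `ℝ⁴`, which
stretch all vectors by one factor `κ` and turn them by one angle. -/
theorem inv_mul_eq_or_mul_inv_eq {a b x y : ℍ[ℝ]} (ha : a ≠ 0) (hb : b ≠ 0) {κ μ : ℝ}
    (hx : ‖x‖ = κ * ‖a‖) (hy : ‖y‖ = κ * ‖b‖) (hxy : ‖x - y‖ = κ * ‖a - b‖)
    (hxa : inner ℝ x a = μ * ‖a‖ ^ 2) (hyb : inner ℝ y b = μ * ‖b‖ ^ 2)
    (hxyab : inner ℝ (x - y) (a - b) = μ * ‖a - b‖ ^ 2) :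
    a⁻¹ * x = b⁻¹ * y ∨ x * a⁻¹ = y * b⁻¹ := by
  obtain ⟨g, rfl⟩ : ∃ g, a = b * g := ⟨b⁻¹ * a, (mul_inv_cancel_left₀ hb a).symm⟩
  obtain ⟨k, rfl⟩ : ∃ k, x = b * g * k := ⟨(b * g)⁻¹ * x, (mul_inv_cancel_left₀ ha x).symm⟩
  obtain ⟨l, rfl⟩ : ∃ l, y = b * l := ⟨b⁻¹ * y, (mul_inv_cancel_left₀ hb y).symm⟩
  have hb' := norm_ne_zero_iff.2 hb
  have inner_mul_self : ∀ c z : ℍ[ℝ], inner ℝ (c * z) c = z.re * ‖c‖ ^ 2 := fun c z => by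
    simpa [inner_def, mul_comm] using inner_mul_mul_left c z 1
  have hk : ‖k‖ = κ := by
    rwa [norm_mul, mul_comm, mul_left_inj' (norm_ne_zero_iff.2 ha)] at hx
  have hl : ‖l‖ = κ := by rwa [norm_mul, mul_comm, mul_left_inj' hb'] at hy
  have hkre : k.re = μ := by
    rwa [inner_mul_self, mul_left_inj' (pow_ne_zero 2 (norm_ne_zero_iff.2 ha))] at hxa
  have hlre : l.re = μ := by rwa [inner_mul_self, mul_left_inj' (pow_ne_zero 2 hb')] at hyb
  have hsub : b * g * k - b * l = b * (g * k - l) := by rw [mul_sub, mul_assoc]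
  have hsub' : b * g - b = b * (g - 1) := by rw [mul_sub, mul_one]
  rw [hsub, hsub', norm_mul, norm_mul, mul_left_comm, mul_right_inj' hb'] at hxy
  rw [hsub, hsub', inner_mul_mul_left, norm_mul, mul_pow, mul_left_comm,
    mul_right_inj' (pow_ne_zero 2 hb')] at hxyab
  have hnorm : ∀ z : ℍ[ℝ], normSq z = ‖z‖ ^ 2 := fun z => by rw [normSq_eq_norm_mul_self, sq]
  rcases eq_or_mul_eq_mul_of_inner_sub (g := g) (hkre.trans hlre.symm)
    (by rw [hnorm, hnorm, hk, hl]) (by rw [hnorm, hnorm, hnorm, hxy, hk, mul_pow])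
    (by rw [hnorm, hkre, hxyab]) with h | h
  · left
    rw [inv_mul_cancel_left₀ ha, inv_mul_cancel_left₀ hb, h]
  · right
    rw [mul_assoc b g, h, ← mul_assoc, mul_inv_rev, mul_assoc (b * l),
      mul_inv_cancel_left₀ (right_ne_zero_of_mul ha)]

end Isoclinic

/-! ## Closed quadrilaterals -/

section Quadrilateral

section DivisionRing

variable {D : Type*} [DivisionRing D]

/-- The sides of the closed quadrilateral `p₁`, `p₂`, `p₄`, `p₅`. When an octahedral configuration
is inverted at its vertex `0`, the four circles through that vertex become the lines along these
sides. -/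
def quadSide (p₁ p₂ p₄ p₅ : D) : Fin 4 → D := ![p₁ - p₅, p₂ - p₁, p₄ - p₂, p₅ - p₄]

/-- The conjugate tangent vectors at `p₁` of the four circles through `p₁` of an octahedral
configuration whose vertices `0` and `3` are `∞` and `0`; they are the vectors
`invDiff p₁ ∞ p₂`, `invDiff p₁ p₅ ∞`, `invDiff p₁ p₂ 0`, `invDiff p₁ 0 p₅` with `∞⁻¹ = 0`. -/
def quadTangent (p₁ p₂ p₅ : D) : Fin 4 → D :=
  ![-(p₂ - p₁)⁻¹, (p₅ - p₁)⁻¹, invDiff p₁ p₂ 0, invDiff p₁ 0 p₅]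

theorem sum_quadSide (p₁ p₂ p₄ p₅ : D) : ∑ i, quadSide p₁ p₂ p₄ p₅ i = 0 := by
  simp [quadSide, Fin.sum_univ_four]

theorem sum_quadTangent (p₁ p₂ p₅ : D) : ∑ i, quadTangent p₁ p₂ p₅ i = 0 := by
  simp only [quadTangent, invDiff, Fin.sum_univ_four, Matrix.cons_val]
  abel

theorem quadTangent_two {p₁ p₂ : D} (p₅ : D) (h₁ : p₁ ≠ 0) (h₁₂ : p₂ ≠ p₁) :
    quadTangent p₁ p₂ p₅ 2 = (p₂ - p₁)⁻¹ * (p₂ * p₁⁻¹) := by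
  change invDiff p₁ p₂ 0 = _
  rw [invDiff_eq_mul h₁₂ h₁.symm, zero_sub, zero_sub, inv_neg, mul_assoc, neg_mul_neg]

theorem quadSide_mul (a b k : D) :
    quadSide (a * k) a b (b * k) = ![-((b - a) * k), a * (1 - k), b - a, -(b * (1 - k))] := by
  rw [quadSide, sub_mul, neg_sub, mul_sub, mul_sub, mul_one, mul_one, neg_sub]

theorem quadTangent_mul {a b k : D} (ha : a ≠ 0) (hab : a ≠ b) (hk : k ≠ 0) (hk1 : k ≠ 1) :
    quadTangent (a * k) a (b * k) =
      ![-(a * (1 - k)), (b - a) * k, a * ((1 - k) * k), -(a * (b⁻¹ * ((b - a) * k)))]⁻¹ := by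
  have hak : a ≠ a * k := fun h => hk1 ((mul_eq_left₀ ha).1 h.symm)
  have hbk : b * k ≠ a * k := fun h => hab (mul_right_cancel₀ hk h).symm
  have hak0 : 0 ≠ a * k := (mul_ne_zero ha hk).symm
  have invDiff_right : invDiff (a * k) a 0 = (a * ((1 - k) * k))⁻¹ := by
    rw [invDiff_eq_mul_rev hak hak0, zero_sub, zero_sub, inv_neg, neg_mul_neg, mul_inv_rev,
      inv_mul_cancel_right₀ ha, ← mul_inv_rev, ← mul_one_sub, mul_assoc]
  have invDiff_left : invDiff (a * k) 0 (b * k) = (-(a * (b⁻¹ * ((b - a) * k))))⁻¹ := by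
    rw [invDiff_eq_mul_rev hak0 hbk, sub_zero, zero_sub, ← sub_mul, inv_neg, inv_neg, mul_inv_rev a,
      mul_inv_rev a, mul_inv_rev b⁻¹, inv_inv, mul_neg, mul_assoc, mul_assoc,
      mul_inv_cancel_left₀ hk, ← mul_assoc]
  rw [quadTangent, invDiff_right, invDiff_left, ← mul_one_sub, ← sub_mul, ← inv_neg]
  funext i
  fin_cases i <;> rfl

end DivisionRing

open InnerProductGeometry

variable {D : Type*} [NormedDivisionRing D] [InnerProductSpace ℝ D]

theorem sameAngles_mul_vectors {a b e q k : D} (ha : a ≠ 0) (hb : b ≠ 0) (he : e ≠ 0)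
    (hq : q ≠ 0) (hk : k ≠ 0) :
    SameAngles ![-(e * k), a * q, e, -(b * q)]
      ![-(a * q), e * k, a * (q * k), -(a * (b⁻¹ * (e * k)))] := by
  have hne : ∀ x y : D, angle (-x) y = angle x (-y) := fun x y => by
    rw [angle_neg_left, angle_neg_right]
  refine .of_fin_four (by simp [Fin.forall_fin_succ, *]) (by simp [Fin.forall_fin_succ, *])
    ?_ ?_ ?_ ?_ ?_ ?_ <;> simp only [Matrix.cons_val]
  · rw [hne, angle_comm]
  · calc angle (-(e * k)) e = angle (e * -k) (e * 1) := by rw [mul_neg, mul_one]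
      _ = angle (-k) 1 := angle_mul_mul_left he _ _
      _ = angle (-1) k := by rw [hne, angle_comm]
      _ = angle (a * (q * -1)) (a * (q * k)) := by
        rw [angle_mul_mul_left ha, angle_mul_mul_left hq]
      _ = angle (-(a * q)) (a * (q * k)) := by rw [mul_neg_one, mul_neg]
  · rw [angle_neg_neg, angle_neg_neg, angle_mul_mul_left ha, ← angle_mul_mul_left hb q,
      mul_inv_cancel_left₀ hb, angle_comm]
  · rw [← mul_assoc, angle_mul_mul_right hk, angle_comm]
  · calc angle (a * q) (-(b * q)) = angle a (-b) := by rw [← neg_mul, angle_mul_mul_right hq]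
      _ = angle (a * b⁻¹ * b) (-1 * b) := by rw [inv_mul_cancel_right₀ hb, neg_one_mul]
      _ = angle 1 (-(a * b⁻¹)) := by rw [angle_mul_mul_right hb, angle_comm, hne]
      _ = angle (1 * (e * k)) (-(a * b⁻¹) * (e * k)) :=
        (angle_mul_mul_right (mul_ne_zero he hk) _ _).symm
      _ = angle (e * k) (-(a * (b⁻¹ * (e * k)))) := by rw [one_mul, neg_mul, mul_assoc]
  · calc angle e (-(b * q)) = angle (b * (b⁻¹ * e)) (b * -q) := by
          rw [mul_inv_cancel_left₀ hb, mul_neg]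
      _ = angle q (-(b⁻¹ * e)) := by rw [angle_mul_mul_left hb, ← hne, angle_comm]
      _ = angle (q * k) (-(b⁻¹ * e) * k) := (angle_mul_mul_right hk _ _).symm
      _ = angle (a * (q * k)) (a * -(b⁻¹ * (e * k))) := by
        rw [angle_mul_mul_left ha, neg_mul, mul_assoc]
      _ = angle (a * (q * k)) (-(a * (b⁻¹ * (e * k)))) := by rw [mul_neg]

theorem sameAngles_quadSide_quadTangent {a b k : D} (ha : a ≠ 0) (hb : b ≠ 0) (hab : a ≠ b)
    (hk : k ≠ 0) (hk1 : k ≠ 1) :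
    SameAngles (quadSide (a * k) a b (b * k)) (quadTangent (a * k) a (b * k)) := by
  have key := sameAngles_mul_vectors ha hb (sub_ne_zero.2 hab.symm) (sub_ne_zero.2 hk1.symm) hk
  intro i j
  rw [quadSide_mul, quadTangent_mul ha hab hk hk1, Pi.inv_apply, Pi.inv_apply, angle_inv_inv]
  exact key i j

section Converse

variable {p₁ p₂ p₄ p₅ : D} (h₁ : p₁ ≠ 0) (h₁₂ : p₂ ≠ p₁)
  (h : SameAngles (quadSide p₁ p₂ p₄ p₅) (quadTangent p₁ p₂ p₅))

include h₁ h₁₂ h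

theorem angle_eq_of_sameAngles_quadSide : angle p₁ p₂ = angle (p₁ - p₅) (p₂ - p₄) := by
  have key : angle (p₁ - p₅) (p₄ - p₂) = angle (-(p₂ - p₁)⁻¹) ((p₂ - p₁)⁻¹ * (p₂ * p₁⁻¹)) := by
    rw [← quadTangent_two p₅ h₁ h₁₂]
    exact h 0 2
  rw [← mul_neg_one, angle_mul_mul_left (inv_ne_zero (sub_ne_zero.2 h₁₂)),
    ← angle_mul_mul_right h₁ (-1), inv_mul_cancel_right₀ h₁, neg_one_mul, ← neg_sub p₂,
    angle_neg_right, angle_neg_left] at key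
  linarith

theorem norm_mul_norm_eq_of_sameAngles_quadSide (h₁₅ : p₁ ≠ p₅)
    (hind : LinearIndepOn ℝ (quadSide p₁ p₂ p₄ p₅) {2, 3}) :
    ‖p₁‖ * ‖p₂ - p₄‖ = ‖p₁ - p₅‖ * ‖p₂‖ := by
  have n₁ : ‖p₁‖ ≠ 0 := norm_ne_zero_iff.2 h₁
  have n₁₂ : ‖p₂ - p₁‖ ≠ 0 := norm_ne_zero_iff.2 (sub_ne_zero.2 h₁₂)
  have n₁₅ : ‖p₁ - p₅‖ ≠ 0 := norm_ne_zero_iff.2 (sub_ne_zero.2 h₁₅)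
  have norm_eq : ∀ i ∉ ({2, 3} : Finset (Fin 4)), ‖quadTangent p₁ p₂ p₅ i‖ =
      (‖p₁ - p₅‖ * ‖p₂ - p₁‖)⁻¹ * ‖quadSide p₁ p₂ p₄ p₅ i‖ := by
    intro i hi
    obtain rfl | rfl : i = 0 ∨ i = 1 := by
      revert i
      decide
    · simp only [quadTangent, quadSide, Matrix.cons_val, norm_neg, norm_inv]
      field_simp
    · simp only [quadTangent, quadSide, Matrix.cons_val, norm_inv, norm_sub_rev p₅]
      field_simp
  have key := h.norm_eq_mul_of_sum_eq_zero (S := {2, 3}) (by simpa using hind)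
    (sum_quadSide p₁ p₂ p₄ p₅) (sum_quadTangent p₁ p₂ p₅) norm_eq 2
  rw [quadTangent_two p₅ h₁ h₁₂, norm_mul, norm_mul, norm_inv, norm_inv,
    show quadSide p₁ p₂ p₄ p₅ 2 = p₄ - p₂ from rfl, norm_sub_rev p₄] at key
  field_simp at key
  linear_combination -key

end Converse

end Quadrilateral

/-! ## Hexagons and their multi-ratios -/

section Hexagon

/-- The arguments, besides `P i`, of the conjugate tangent vectors at the vertex `P i` of a hexagon
`P` whose vertices carry an octahedral configuration: `P i` and `P (i + 3)` are opposite vertices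
of the octahedron, and the four columns are the classes of corresponding circles. -/
def hexNext : Fin 6 → Fin 4 → Fin 6 × Fin 6 :=
  ![![(1, 5), (2, 1), (4, 2), (5, 4)], ![(0, 2), (5, 0), (2, 3), (3, 5)],
    ![(3, 1), (0, 4), (1, 0), (4, 3)], ![(2, 4), (4, 5), (5, 1), (1, 2)],
    ![(5, 3), (3, 2), (0, 5), (2, 0)], ![(4, 0), (1, 3), (3, 4), (0, 1)]]

section DivisionRing

variable {D : Type*} [DivisionRing D]

/-- The conjugate tangent vectors at the vertices of an octahedral configuration, numbered by the
vertex and the class of the circle. -/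
def hexTangent (P : Fin 6 → D) (i : Fin 6) (c : Fin 4) : D :=
  invDiff (P i) (P (hexNext i c).1) (P (hexNext i c).2)

/-- The vertices of a hexagon after the inversion at `P 0` and the translation that moves the image
of `P 3` to the origin. -/
def hexInv (P : Fin 6 → D) (j : Fin 6) : D := invDiff (P 0) (P j) (P 3)

variable {P : Fin 6 → D}

theorem hexInv_sub_hexInv (P : Fin 6 → D) (i j : Fin 6) :
    hexInv P i - hexInv P j = invDiff (P 0) (P i) (P j) :=
  sub_sub_sub_cancel_right _ _ _

theorem hexInv_three (P : Fin 6 → D) : hexInv P 3 = 0 := sub_self _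

theorem hexInv_injective (hP : P.Injective) : (hexInv P).Injective := fun _ _ h =>
  hP (sub_left_injective (inv_injective (sub_left_injective h)))

theorem hexInv_ne_zero (hP : P.Injective) {j : Fin 6} (hj : j ≠ 3) : hexInv P j ≠ 0 :=
  hexInv_three P ▸ (hexInv_injective hP).ne hj

theorem hexTangent_zero (P : Fin 6 → D) :
    hexTangent P 0 = quadSide (hexInv P 1) (hexInv P 2) (hexInv P 4) (hexInv P 5) := by
  simp only [quadSide, hexInv_sub_hexInv]
  funext c
  fin_cases c <;> rfl

theorem hexTangent_one (hP : P.Injective) (c : Fin 4) :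
    hexTangent P 1 c = -((P 1 - P 0)⁻¹ *
      quadTangent (hexInv P 1) (hexInv P 2) (hexInv P 5) c * (P 1 - P 0)⁻¹) := by
  have invDiff_zero : ∀ {y : Fin 6}, y ≠ 0 → y ≠ 1 →
      invDiff (P 1) (P 0) (P y) = (P 1 - P 0)⁻¹ * (hexInv P y - hexInv P 1)⁻¹ * (P 1 - P 0)⁻¹ := by
    intro y hy0 hy1
    rw [hexInv_sub_hexInv, ← invDiff_sub_sub _ _ _ (P 0), sub_self]
    exact invDiff_zero_left (sub_ne_zero.2 (hP.ne (by decide))) (sub_ne_zero.2 (hP.ne hy0))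
      (sub_left_injective.ne (hP.ne hy1))
  have invDiff_of_ne : ∀ {y z : Fin 6}, y ≠ 0 → y ≠ 1 → z ≠ 0 → z ≠ 1 → invDiff (P 1) (P y) (P z) =
      -((P 1 - P 0)⁻¹ * invDiff (hexInv P 1) (hexInv P y) (hexInv P z) * (P 1 - P 0)⁻¹) := by
    intro y z hy0 hy1 hz0 hz1
    rw [hexInv, hexInv, hexInv, invDiff.eq_1 (P 0), invDiff.eq_1 (P 0), invDiff.eq_1 (P 0),
      invDiff_sub_sub, invDiff_inv (sub_ne_zero.2 (hP.ne (by decide))) (sub_ne_zero.2 (hP.ne hy0))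
        (sub_ne_zero.2 (hP.ne hz0)) (sub_left_injective.ne (hP.ne hy1))
        (sub_left_injective.ne (hP.ne hz1)), neg_neg, invDiff_sub_sub]
  simp only [quadTangent, ← hexInv_three P]
  fin_cases c
  · change invDiff (P 1) (P 0) (P 2) = -(_ * -(hexInv P 2 - hexInv P 1)⁻¹ * _)
    rw [invDiff_zero (by decide) (by decide), mul_neg, neg_mul, neg_neg]
  · change invDiff (P 1) (P 5) (P 0) = _
    rw [invDiff_swap, invDiff_zero (by decide) (by decide)]
    rfl
  · exact invDiff_of_ne (by decide) (by decide) (by decide) (by decide)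
  · exact invDiff_of_ne (by decide) (by decide) (by decide) (by decide)

theorem hexTangent_comp_add_two (P : Fin 6 → D) (i : Fin 6) :
    hexTangent P (i + 2) = hexTangent (P ∘ (· + 2)) i ∘ ![0, 2, 3, 1] := by
  funext c
  fin_cases i <;> fin_cases c <;> rfl

theorem hexTangent_comp_neg (P : Fin 6 → D) (i : Fin 6) (c : Fin 4) :
    hexTangent (P ∘ Neg.neg) i c = -hexTangent P (-i) (![0, 3, 2, 1] c) := by
  rw [hexTangent, hexTangent, ← invDiff_swap]
  fin_cases i <;> fin_cases c <;> rfl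

end DivisionRing

section SameAngles

open InnerProductGeometry

variable {D : Type*} [NormedDivisionRing D] [InnerProductSpace ℝ D] {P : Fin 6 → D} {i j : Fin 6}

theorem sameAngles_hexTangent_one (hP : P.Injective) :
    SameAngles (hexTangent P 1) (quadTangent (hexInv P 1) (hexInv P 2) (hexInv P 5)) := by
  have h : (P 1 - P 0)⁻¹ ≠ 0 := inv_ne_zero (sub_ne_zero.2 (hP.ne (by decide)))
  intro c d
  rw [hexTangent_one hP, hexTangent_one hP, angle_neg_neg, angle_mul_mul_right h,
    angle_mul_mul_left h]

theorem sameAngles_hexTangent_of_comp_add_two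
    (h : SameAngles (hexTangent (P ∘ (· + 2)) i) (hexTangent (P ∘ (· + 2)) j)) :
    SameAngles (hexTangent P (i + 2)) (hexTangent P (j + 2)) := by
  rw [hexTangent_comp_add_two, hexTangent_comp_add_two]
  exact h.comp _

theorem sameAngles_hexTangent_comp_neg
    (h : SameAngles (hexTangent P (-i)) (hexTangent P (-j))) :
    SameAngles (hexTangent (P ∘ Neg.neg) i) (hexTangent (P ∘ Neg.neg) j) := fun c d => by
  rw [hexTangent_comp_neg, hexTangent_comp_neg, hexTangent_comp_neg, hexTangent_comp_neg,
    angle_neg_neg, angle_neg_neg]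
  exact h _ _

theorem sameAngles_hexTangent_of_comp_neg
    (h : SameAngles (hexTangent (P ∘ Neg.neg) i) (hexTangent (P ∘ Neg.neg) j)) :
    SameAngles (hexTangent P (-i)) (hexTangent P (-j)) := by
  rw [← neg_neg i, ← neg_neg j] at h
  simpa [Function.comp_def] using sameAngles_hexTangent_comp_neg h

theorem linearIndepOn_hexTangent_comp_neg (h : LinearIndepOn ℝ (hexTangent P 0) {1, 2}) :
    LinearIndepOn ℝ (hexTangent (P ∘ Neg.neg) 0) {2, 3} := by
  have h₂ : hexTangent (P ∘ Neg.neg) 0 2 = -hexTangent P 0 2 := hexTangent_comp_neg P 0 2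
  have h₃ : hexTangent (P ∘ Neg.neg) 0 3 = -hexTangent P 0 1 := hexTangent_comp_neg P 0 3
  have ne_zero : hexTangent P 0 1 ≠ 0 := h.ne_zero (by simp)
  rw [linearIndepOn_pair_iff _ (by decide) ne_zero] at h
  rw [Set.pair_comm, linearIndepOn_pair_iff _ (by decide) (h₃ ▸ neg_ne_zero.2 ne_zero), h₂, h₃]
  simpa only [smul_neg, ne_eq, neg_inj] using h

theorem angle_and_norm_hexInv (hP : P.Injective)
    (h01 : SameAngles (hexTangent P 0) (hexTangent P 1))
    (hind : LinearIndepOn ℝ (hexTangent P 0) {2, 3}) :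
    angle (hexInv P 1) (hexInv P 2) =
        angle (hexInv P 1 - hexInv P 5) (hexInv P 2 - hexInv P 4) ∧
      ‖hexInv P 1‖ * ‖hexInv P 2 - hexInv P 4‖ = ‖hexInv P 1 - hexInv P 5‖ * ‖hexInv P 2‖ := by
  have h₁ : hexInv P 1 ≠ 0 := hexInv_ne_zero hP (by decide)
  have h₁₂ : hexInv P 2 ≠ hexInv P 1 := (hexInv_injective hP).ne (by decide)
  have h := h01.trans (sameAngles_hexTangent_one hP)
  rw [hexTangent_zero] at h hind
  exact ⟨angle_eq_of_sameAngles_quadSide h₁ h₁₂ h, norm_mul_norm_eq_of_sameAngles_quadSide h₁ h₁₂ h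
    ((hexInv_injective hP).ne (by decide)) hind⟩

end SameAngles

section MultiRatio

variable {P : Fin 6 → ℍ[ℝ]}

theorem rightMultiRatio_eq_hexInv (hP : P.Injective) :
    rightMultiRatio (P 0) (P 1) (P 2) (P 3) (P 4) (P 5) =
      -((hexInv P 2 - hexInv P 1)⁻¹ * (hexInv P 3 - hexInv P 2) * (hexInv P 4 - hexInv P 3)⁻¹
        * (hexInv P 5 - hexInv P 4)) := by
  have h : ∀ {j : Fin 6}, j ≠ 0 → P j - P 0 ≠ 0 := fun hj => sub_ne_zero.2 (hP.ne hj)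
  have sub_eq : ∀ {i j : Fin 6}, i ≠ 0 → j ≠ 0 →
      P i - P j = (P i - P 0) * (hexInv P j - hexInv P i) * (P j - P 0) := by
    intro i j hi hj
    rw [hexInv_sub_hexInv, invDiff_eq_mul_rev (hP.ne hj) (hP.ne hi), mul_assoc (P i - P 0)⁻¹,
      mul_inv_cancel_left₀ (h hi), inv_mul_cancel_right₀ (h hj)]
  have sub_eq_rev : ∀ {i j : Fin 6}, i ≠ 0 → j ≠ 0 →
      P i - P j = (P j - P 0) * (hexInv P j - hexInv P i) * (P i - P 0) := by
    intro i j hi hj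
    rw [← neg_sub, sub_eq hj hi, ← neg_sub (hexInv P j), mul_neg, neg_mul, neg_neg]
  rw [rightMultiRatio, sub_eq_rev (i := 1) (j := 2) (by decide) (by decide),
    sub_eq (i := 2) (j := 3) (by decide) (by decide),
    sub_eq_rev (i := 3) (j := 4) (by decide) (by decide),
    sub_eq (i := 4) (j := 5) (by decide) (by decide), ← neg_sub (P 1)]
  simp only [mul_inv_rev, mul_assoc, neg_mul]
  rw [mul_inv_cancel_left₀ (h (by decide)), inv_mul_cancel_left₀ (h (by decide)),
    mul_inv_cancel_left₀ (h (by decide)), inv_mul_cancel_left₀ (h (by decide)),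
    mul_inv_cancel₀ (h (by decide)), mul_one]

theorem rightMultiRatio_eq_neg_one_iff (hP : P.Injective) :
    rightMultiRatio (P 0) (P 1) (P 2) (P 3) (P 4) (P 5) = -1 ↔
      (hexInv P 2)⁻¹ * hexInv P 1 = (hexInv P 4)⁻¹ * hexInv P 5 := by
  have h2 := hexInv_ne_zero hP (j := 2) (by decide)
  have h4 := hexInv_ne_zero hP (j := 4) (by decide)
  have h12 : hexInv P 2 - hexInv P 1 ≠ 0 := sub_ne_zero.2 ((hexInv_injective hP).ne (by decide))
  rw [rightMultiRatio_eq_hexInv hP, neg_inj, hexInv_three, zero_sub, sub_zero, mul_assoc,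
    mul_assoc, inv_mul_eq_one₀ h12, mul_sub, inv_mul_cancel₀ h4, mul_sub, mul_one, neg_mul,
    sub_neg_eq_add, neg_add_eq_sub, sub_right_inj, inv_mul_eq_iff_eq_mul₀ h2]

theorem leftMultiRatio_eq_star (p₁ p₂ p₃ p₄ p₅ p₆ : ℍ[ℝ]) :
    leftMultiRatio p₁ p₂ p₃ p₄ p₅ p₆ =
      star (rightMultiRatio (star p₁) (star p₂) (star p₃) (star p₄) (star p₅) (star p₆)) := by
  simp only [leftMultiRatio, rightMultiRatio, ← star_sub, ← star_inv₀, star_mul, star_star,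
    mul_assoc]
  rw [← neg_sub p₆, ← neg_sub p₅ p₆, ← neg_sub p₄ p₅, ← neg_sub p₃ p₄, ← neg_sub p₂ p₃,
    ← neg_sub p₁ p₂]
  simp only [inv_neg, neg_mul, mul_neg, neg_neg]

theorem leftMultiRatio_eq_neg_one_iff_star (p₁ p₂ p₃ p₄ p₅ p₆ : ℍ[ℝ]) :
    leftMultiRatio p₁ p₂ p₃ p₄ p₅ p₆ = -1 ↔
      rightMultiRatio (star p₁) (star p₂) (star p₃) (star p₄) (star p₅) (star p₆) = -1 := by
  rw [leftMultiRatio_eq_star, star_eq_iff_star_eq, star_neg, star_one, eq_comm]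

theorem leftMultiRatio_eq_neg_one_iff (hP : P.Injective) :
    leftMultiRatio (P 0) (P 1) (P 2) (P 3) (P 4) (P 5) = -1 ↔
      hexInv P 1 * (hexInv P 2)⁻¹ = hexInv P 5 * (hexInv P 4)⁻¹ := by
  have hexInv_star : ∀ j, hexInv (star ∘ P) j = star (hexInv P j) := fun j => by
    simp only [hexInv, invDiff, Function.comp_apply, star_sub, star_inv₀]
  rw [leftMultiRatio_eq_neg_one_iff_star]
  refine (rightMultiRatio_eq_neg_one_iff (star_injective.comp hP)).trans ?_
  rw [hexInv_star, hexInv_star, hexInv_star, hexInv_star, ← star_inv₀, ← star_inv₀, ← star_mul,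
    ← star_mul, star_inj]

theorem rightMultiRatio_eq_neg_one_rotate {p₁ p₂ p₃ p₄ p₅ p₆ : ℍ[ℝ]}
    (h : rightMultiRatio p₁ p₂ p₃ p₄ p₅ p₆ = -1) : rightMultiRatio p₃ p₄ p₅ p₆ p₁ p₂ = -1 := by
  have mul_eq_one : (p₁ - p₂) * (p₂ - p₃)⁻¹ *
      -((p₃ - p₄) * (p₄ - p₅)⁻¹ * (p₅ - p₆) * (p₆ - p₁)⁻¹) = 1 := by
    rw [mul_neg, neg_eq_iff_eq_neg, ← h]
    simp only [rightMultiRatio, mul_assoc]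
  rw [mul_eq_one_comm, neg_mul, neg_eq_iff_eq_neg] at mul_eq_one
  rw [← mul_eq_one]
  simp only [rightMultiRatio, mul_assoc]

theorem rightMultiRatio_eq_neg_one_reverse (hP : P.Injective)
    (h : rightMultiRatio (P 0) (P 1) (P 2) (P 3) (P 4) (P 5) = -1) :
    rightMultiRatio (P 0) (P 5) (P 4) (P 3) (P 2) (P 1) = -1 :=
  (rightMultiRatio_eq_neg_one_iff (P := P ∘ Neg.neg) (hP.comp neg_injective)).2
    ((rightMultiRatio_eq_neg_one_iff hP).1 h).symm

theorem sameAngles_zero_one_of_rightMultiRatio (hP : P.Injective)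
    (hM : rightMultiRatio (P 0) (P 1) (P 2) (P 3) (P 4) (P 5) = -1) :
    SameAngles (hexTangent P 0) (hexTangent P 1) := by
  have h := hexInv_injective hP
  have ha : hexInv P 2 ≠ 0 := hexInv_ne_zero hP (by decide)
  have hb : hexInv P 4 ≠ 0 := hexInv_ne_zero hP (by decide)
  have h₁ : hexInv P 1 ≠ 0 := hexInv_ne_zero hP (by decide)
  obtain ⟨k, e₁, e₅⟩ : ∃ k, hexInv P 1 = hexInv P 2 * k ∧ hexInv P 5 = hexInv P 4 * k :=
    ⟨(hexInv P 2)⁻¹ * hexInv P 1, (mul_inv_cancel_left₀ ha _).symm,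
      by rw [(rightMultiRatio_eq_neg_one_iff hP).1 hM, mul_inv_cancel_left₀ hb]⟩
  have hk : k ≠ 0 := right_ne_zero_of_mul (e₁ ▸ h₁)
  have hk1 : k ≠ 1 := by
    rintro rfl
    exact absurd (h (e₁.trans (mul_one _))) (by decide)
  refine .trans ?_ (sameAngles_hexTangent_one hP).symm
  rw [hexTangent_zero, e₁, e₅]
  exact sameAngles_quadSide_quadTangent ha hb (h.ne (by decide)) hk hk1

theorem sameAngles_zero_five_of_rightMultiRatio (hP : P.Injective)
    (hM : rightMultiRatio (P 0) (P 1) (P 2) (P 3) (P 4) (P 5) = -1) :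
    SameAngles (hexTangent P 0) (hexTangent P 5) :=
  sameAngles_hexTangent_of_comp_neg (P := P) (i := 0) (j := 1) <|
    sameAngles_zero_one_of_rightMultiRatio (P := P ∘ Neg.neg) (hP.comp neg_injective)
      (rightMultiRatio_eq_neg_one_reverse (P := P) hP hM)

theorem sameAngles_of_rightMultiRatio (hP : P.Injective)
    (hM : rightMultiRatio (P 0) (P 1) (P 2) (P 3) (P 4) (P 5) = -1) (i j : Fin 6) :
    SameAngles (hexTangent P i) (hexTangent P j) := by
  have h01 := sameAngles_zero_one_of_rightMultiRatio hP hM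
  have h05 := sameAngles_zero_five_of_rightMultiRatio hP hM
  have hM₂ := rightMultiRatio_eq_neg_one_rotate hM
  have hP₂ : (P ∘ (· + 2)).Injective := hP.comp (add_left_injective 2)
  have h23 : SameAngles (hexTangent P 2) (hexTangent P 3) :=
    sameAngles_hexTangent_of_comp_add_two (i := 0) (j := 1)
      (sameAngles_zero_one_of_rightMultiRatio (P := P ∘ (· + 2)) hP₂ hM₂)
  have h21 : SameAngles (hexTangent P 2) (hexTangent P 1) :=
    sameAngles_hexTangent_of_comp_add_two (i := 0) (j := 5)
      (sameAngles_zero_five_of_rightMultiRatio (P := P ∘ (· + 2)) hP₂ hM₂)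
  have h45 : SameAngles (hexTangent P 4) (hexTangent P 5) :=
    sameAngles_hexTangent_of_comp_add_two (i := 2) (j := 3) <|
      sameAngles_hexTangent_of_comp_add_two (P := P ∘ (· + 2)) (i := 0) (j := 1) <|
        sameAngles_zero_one_of_rightMultiRatio (P := (P ∘ (· + 2)) ∘ (· + 2))
          (hP₂.comp (add_left_injective 2)) (rightMultiRatio_eq_neg_one_rotate hM₂)
  have h0 : ∀ i, SameAngles (hexTangent P 0) (hexTangent P i) := by
    intro i
    fin_cases i
    exacts [fun _ _ => rfl, h01, h01.trans h21.symm, h01.trans (h21.symm.trans h23),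
      h05.trans h45.symm, h05]
  exact (h0 i).symm.trans (h0 j)

theorem sameAngles_of_leftMultiRatio (hP : P.Injective)
    (hM : leftMultiRatio (P 0) (P 1) (P 2) (P 3) (P 4) (P 5) = -1) (i j : Fin 6) :
    SameAngles (hexTangent P i) (hexTangent P j) := by
  have hexTangent_star : ∀ i c, hexTangent (star ∘ P) i c = star (hexTangent P i c) := fun i c => by
    simp only [hexTangent, invDiff, Function.comp_apply, star_sub, star_inv₀]
  have h := sameAngles_of_rightMultiRatio (star_injective.comp hP)
    ((leftMultiRatio_eq_neg_one_iff_star _ _ _ _ _ _).1 hM) i j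
  intro c d
  simpa only [hexTangent_star, angle_star_star] using h c d

open InnerProductGeometry in
theorem multiRatio_eq_neg_one_of_sameAngles (hP : P.Injective)
    (h01 : SameAngles (hexTangent P 0) (hexTangent P 1))
    (h05 : SameAngles (hexTangent P 0) (hexTangent P 5))
    (h23 : LinearIndepOn ℝ (hexTangent P 0) {2, 3})
    (h12 : LinearIndepOn ℝ (hexTangent P 0) {1, 2}) :
    rightMultiRatio (P 0) (P 1) (P 2) (P 3) (P 4) (P 5) = -1 ∨
      leftMultiRatio (P 0) (P 1) (P 2) (P 3) (P 4) (P 5) = -1 := by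
  have h := hexInv_injective hP
  have ha : hexInv P 2 ≠ 0 := hexInv_ne_zero hP (by decide)
  have hb : hexInv P 4 ≠ 0 := hexInv_ne_zero hP (by decide)
  have hab : ‖hexInv P 2 - hexInv P 4‖ ≠ 0 := norm_ne_zero_iff.2 (sub_ne_zero.2 (h.ne (by decide)))
  obtain ⟨angle_xa, norm_x⟩ := angle_and_norm_hexInv hP h01 h23
  obtain ⟨angle_yb, norm_y⟩ := angle_and_norm_hexInv (P := P ∘ Neg.neg) (hP.comp neg_injective)
    (sameAngles_hexTangent_comp_neg (i := 0) (j := 1) h05)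
    (linearIndepOn_hexTangent_comp_neg h12)
  change angle (hexInv P 5) (hexInv P 4) =
    angle (hexInv P 5 - hexInv P 1) (hexInv P 4 - hexInv P 2) at angle_yb
  change ‖hexInv P 5‖ * ‖hexInv P 4 - hexInv P 2‖ = ‖hexInv P 5 - hexInv P 1‖ * ‖hexInv P 4‖
    at norm_y
  rw [← neg_sub (hexInv P 1), ← neg_sub (hexInv P 2), angle_neg_neg] at angle_yb
  rw [norm_sub_rev (hexInv P 4), norm_sub_rev (hexInv P 5)] at norm_y
  have inner_eq : ∀ {x a : ℍ[ℝ]} {κ : ℝ}, ‖x‖ = κ * ‖a‖ →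
      inner ℝ x a = κ * Real.cos (angle x a) * ‖a‖ ^ 2 := fun {x a κ} hx => by
    rw [← cos_angle_mul_norm_mul_norm, hx]
    ring
  rw [rightMultiRatio_eq_neg_one_iff hP, leftMultiRatio_eq_neg_one_iff hP]
  have hx := (eq_div_of_mul_eq hab norm_x).trans (mul_div_right_comm _ _ _)
  have hy := (eq_div_of_mul_eq hab norm_y).trans (mul_div_right_comm _ _ _)
  have hxy := (div_mul_cancel₀ ‖hexInv P 1 - hexInv P 5‖ hab).symm
  exact inv_mul_eq_or_mul_inv_eq ha hb hx hy hxy (angle_xa ▸ inner_eq hx)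
    (angle_yb ▸ inner_eq hy) (inner_eq hxy)

end MultiRatio

end Hexagon

/-! ## Tangent vectors of oriented circles -/

section Circle

theorem cot_lt_cot {x y : ℝ} (hx : 0 < x) (hxy : x < y) (hy : y < Real.pi) :
    Real.cot y < Real.cot x := by
  have hsx : 0 < Real.sin x := Real.sin_pos_of_pos_of_lt_pi hx (hxy.trans hy)
  have hsy : 0 < Real.sin y := Real.sin_pos_of_pos_of_lt_pi (hx.trans hxy) hy
  have h : 0 < Real.sin (y - x) := Real.sin_pos_of_pos_of_lt_pi (by linarith) (by linarith)
  rw [Real.sin_sub] at h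
  rw [Real.cot_eq_cos_div_sin, Real.cot_eq_cos_div_sin, div_lt_div_iff₀ hsy hsx]
  linarith

theorem norm_neg_sin_smul_add_cos_smul {V : Type*} [NormedAddCommGroup V] [InnerProductSpace ℝ V]
    {u w : V} (hu : ‖u‖ = 1) (hw : ‖w‖ = 1) (huw : inner ℝ u w = 0) (φ : ℝ) :
    ‖-Real.sin φ • u + Real.cos φ • w‖ = 1 := by
  rw [← pow_eq_one_iff_of_nonneg (norm_nonneg _) two_ne_zero, norm_add_sq_real, norm_smul,
    norm_smul, real_inner_smul_left, real_inner_smul_right, hu, hw, huw, mul_one, mul_one,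
    Real.norm_eq_abs, Real.norm_eq_abs, sq_abs, sq_abs]
  linear_combination Real.sin_sq_add_cos_sq φ

theorem star_inv_smul_of_norm_eq_one {p : ℍ[ℝ]} (hp : ‖p‖ = 1) (s : ℝ) :
    star (s • p)⁻¹ = s⁻¹ • p := by
  rw [smul_inv₀, Quaternion.star_smul, Quaternion.inv_def p, Quaternion.normSq_eq_norm_mul_self,
    hp, mul_one, inv_one, one_smul, star_star]

namespace OrientedCircle

section CircleCase

variable (o : ℍ[ℝ]) {u w : ℍ[ℝ]} {r : ℝ} (hr : 0 < r) (hu : ‖u‖ = 1) (hw : ‖w‖ = 1)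
  (huw : inner ℝ u w = 0) (a : ℝ)

theorem circle_curve_add_sub_curve (δ : ℝ) :
    (circle o u w r hr hu hw huw).curve (a + 2 * δ) - (circle o u w r hr hu hw huw).curve a =
      (2 * r * Real.sin δ) • (-Real.sin (a + δ) • u + Real.cos (a + δ) • w) := by
  obtain ⟨m, rfl⟩ : ∃ m, a = m - δ := ⟨a + δ, (add_sub_cancel_right a δ).symm⟩
  rw [show m - δ + 2 * δ = m + δ by ring, sub_add_cancel]
  simp only [curve, Real.cos_add, Real.sin_add, Real.cos_sub, Real.sin_sub]
  module

theorem circle_tangent_curve :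
    (circle o u w r hr hu hw huw).tangent ((circle o u w r hr hu hw huw).curve a) =
      r • (-Real.sin a • u + Real.cos a • w) := by
  simp only [tangent, curve, add_assoc, add_sub_cancel_left, inner_add_left, real_inner_smul_left,
    huw, real_inner_comm u w, real_inner_self_eq_norm_sq, hu, hw]
  module

theorem circle_star_inv_curve_add_sub_curve {δ : ℝ} (hδ : Real.sin δ ≠ 0) :
    star ((circle o u w r hr hu hw huw).curve (a + 2 * δ) -
        (circle o u w r hr hu hw huw).curve a)⁻¹ =
      -(2 * r)⁻¹ • (Real.cos a • u + Real.sin a • w) + (Real.cot δ / (2 * r ^ 2)) •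
        (circle o u w r hr hu hw huw).tangent ((circle o u w r hr hu hw huw).curve a) := by
  rw [circle_curve_add_sub_curve, circle_tangent_curve,
    star_inv_smul_of_norm_eq_one (norm_neg_sin_smul_add_cos_smul hu hw huw _), Real.sin_add,
    Real.cos_add, Real.cot_eq_cos_div_sin]
  match_scalars <;> field_simp <;> ring

end CircleCase

theorem line_star_inv_curve_sub_curve (p : ℍ[ℝ]) {u : ℍ[ℝ]} (hu : ‖u‖ = 1) (a t : ℝ) :
    star ((line p u hu).curve t - (line p u hu).curve a)⁻¹ = (t - a)⁻¹ • u := by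
  rw [curve, curve, add_sub_add_left_eq_sub, ← sub_smul, star_inv_smul_of_norm_eq_one hu]

/-- The map `p ↦ star (p - x)⁻¹` is the inversion at `x`. It reverses the direction of the circle,
whence `γ < β`. -/
theorem Traverses.exists_inversion_line {C : OrientedCircle} {x y z : ℍ[ℝ]}
    (h : C.Traverses x y z) :
    ∃ (n : ℍ[ℝ]) (β γ : ℝ), γ < β ∧ star (y - x)⁻¹ = n + β • C.tangent x ∧
      star (z - x)⁻¹ = n + γ • C.tangent x ∧
      ∀ (p : ℍ[ℝ]) (t : ℝ), star (p - x)⁻¹ = n + t • C.tangent x → p ∈ C.carrier := by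
  cases C with
  | circle o u w r hr hu hw huw =>
    obtain ⟨a, b, c, rfl, rfl, rfl, hab, hbc, hca⟩ := h
    have star_inv := @circle_star_inv_curve_add_sub_curve o u w r hr hu hw huw a
    have sin_ne_zero : ∀ {t}, a < t → t < a + 2 * Real.pi → Real.sin ((t - a) / 2) ≠ 0 :=
      fun h1 h2 => (Real.sin_pos_of_pos_of_lt_pi (by linarith) (by linarith)).ne'
    have star_inv_b := star_inv (sin_ne_zero hab (by linarith))
    have star_inv_c := star_inv (sin_ne_zero (hab.trans hbc) hca)
    rw [mul_div_cancel₀ _ two_ne_zero, add_sub_cancel] at star_inv_b star_inv_c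
    refine ⟨_, _, _, ?_, star_inv_b, star_inv_c, fun p t hp => ?_⟩
    · gcongr
      exact cot_lt_cot (by linarith) (by linarith) (by linarith)
    · have hsin : Real.sin (Real.pi / 2 - Real.arctan (2 * r ^ 2 * t)) ≠ 0 := by
        rw [Real.sin_pi_div_two_sub]
        exact (Real.cos_arctan_pos _).ne'
      have e := star_inv hsin
      rw [Real.cot_eq_cos_div_sin, Real.cos_pi_div_two_sub, Real.sin_pi_div_two_sub,
        ← Real.tan_eq_sin_div_cos, Real.tan_arctan, mul_div_cancel_left₀ _ (by positivity), ← hp,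
        star_inj, inv_inj, sub_left_inj] at e
      exact ⟨_, e⟩
  | line p u hu =>
    obtain ⟨a, b, c, rfl, rfl, rfl, h⟩ := h
    have star_inv : ∀ t, star ((line p u hu).curve t - (line p u hu).curve a)⁻¹ =
        0 + (t - a)⁻¹ • u := fun t => by rw [line_star_inv_curve_sub_curve, zero_add]
    refine ⟨0, _, _, ?_, star_inv b, star_inv c, fun q t hq => ⟨a + t⁻¹, ?_⟩⟩
    · rcases h with h | h | h
      · exact inv_strictAnti₀ (by linarith) (by linarith)
      · exact (inv_lt_inv_of_neg (by linarith) (by linarith)).2 (by linarith)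
      · exact (inv_lt_zero.2 (by linarith)).trans (inv_pos.2 (by linarith))
    · change star (q - _)⁻¹ = 0 + t • u at hq
      have e := star_inv (a + t⁻¹)
      rwa [add_sub_cancel_left, inv_inv, ← hq, star_inj, inv_inj, sub_left_inj] at e

theorem Traverses.exists_tangent_eq_smul {C : OrientedCircle} {x y z : ℍ[ℝ]}
    (h : C.Traverses x y z) : ∃ r : ℝ, 0 < r ∧ C.tangent x = r • star (invDiff x y z) := by
  obtain ⟨n, β, γ, hlt, hy, hz, -⟩ := h.exists_inversion_line
  refine ⟨(β - γ)⁻¹, inv_pos.2 (sub_pos.2 hlt), ?_⟩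
  rw [invDiff, star_sub, hy, hz, add_sub_add_left_eq_sub, ← sub_smul,
    inv_smul_smul₀ (sub_pos.2 hlt).ne']

theorem Traverses.mem_carrier_of_invDiff_eq_smul {C : OrientedCircle} {x y z p : ℍ[ℝ]}
    (h : C.Traverses x y z) {s : ℝ} (hp : invDiff x y p = s • invDiff x y z) : p ∈ C.carrier := by
  obtain ⟨n, β, γ, -, hy, hz, hmem⟩ := h.exists_inversion_line
  refine hmem p (β - s * (β - γ)) ?_
  rw [invDiff, sub_eq_iff_eq_add, ← sub_eq_iff_eq_add'] at hp
  rw [← hp, invDiff, star_sub, Quaternion.star_smul, star_sub, hy, hz]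
  module

theorem Traverses.rotate {C : OrientedCircle} {x y z : ℍ[ℝ]} (h : C.Traverses x y z) :
    C.Traverses y z x := by
  cases C with
  | circle o u w r hr hu hw huw =>
    obtain ⟨a, b, c, rfl, hb, hc, hab, hbc, hca⟩ := h
    refine ⟨b, c, a + 2 * Real.pi, hb, hc, ?_, hbc, hca, by linarith⟩
    simp only [curve, Real.cos_add_two_pi, Real.sin_add_two_pi]
  | line p u hu =>
    obtain ⟨a, b, c, ha, hb, hc, h⟩ := h
    exact ⟨b, c, a, hb, hc, ha, by tauto⟩

end OrientedCircle

end Circle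

/-! ## Corresponding faces -/

section Combinatorics

instance : DecidableEq OctVertex := fun v w => by
  cases v <;> cases w <;> first | exact isTrue rfl | exact isFalse nofun

instance : DecidableEq OctFace := fun f g => by
  cases f <;> cases g <;> first | exact isTrue rfl | exact isFalse nofun

instance (f : OctFace) (v : OctVertex) : Decidable (f.Has v) :=
  inferInstanceAs (Decidable (∃ i, f.vertex i = v))

/-- A closed path along edges of the octahedron that visits every vertex once, in the order of the
multi-ratios. -/
def hexVertex : Fin 6 → OctVertex := ![.v14, .v12, .v24, .v23, .v34, .v13]

/-- The face at the vertex `hexVertex i` whose circle belongs to the class `c`. The classes are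
those of the correspondence; see `octCorresponds_iff`. -/
def hexFace : Fin 6 → Fin 4 → OctFace :=
  ![![.s1, .s124, .s4, .s134], ![.s124, .s1, .s2, .s123], ![.s2, .s4, .s124, .s234],
    ![.s234, .s3, .s123, .s2], ![.s3, .s234, .s134, .s4], ![.s134, .s123, .s3, .s1]]

theorem hexVertex_injective : hexVertex.Injective := by decide

theorem hexVertex_surjective : hexVertex.Surjective := by
  intro v
  cases v
  exacts [⟨1, rfl⟩, ⟨5, rfl⟩, ⟨0, rfl⟩, ⟨3, rfl⟩, ⟨2, rfl⟩, ⟨4, rfl⟩]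

theorem hexFace_injective (i : Fin 6) : (hexFace i).Injective := by
  revert i
  unfold Function.Injective
  decide

theorem has_hexVertex_iff {f : OctFace} {i : Fin 6} :
    f.Has (hexVertex i) ↔ ∃ c, hexFace i c = f := by
  cases f <;> revert i <;> decide

theorem has_hexFace (i : Fin 6) (c : Fin 4) : (hexFace i c).Has (hexVertex i) :=
  has_hexVertex_iff.2 ⟨c, rfl⟩

theorem exists_hexFace_not_has {i j : Fin 6} (hij : i ≠ j) :
    ∃ c, ¬(hexFace i c).Has (hexVertex j) := by
  revert i j
  decide

theorem vertex_hexFace (i : Fin 6) (c : Fin 4) :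
    ∃ k, (hexFace i c).vertex k = hexVertex i ∧
      (hexFace i c).vertex (k + 1) = hexVertex (hexNext i c).1 ∧
      (hexFace i c).vertex (k + 2) = hexVertex (hexNext i c).2 := by
  revert i c
  decide

theorem opp_hexVertex (i : Fin 6) : (hexVertex i).opp = hexVertex (i + 3) := by
  revert i
  decide

theorem opp_hexFace (i : Fin 6) (c : Fin 4) : (hexFace i c).opp = hexFace (i + 3) c := by
  revert i c
  decide

theorem eq_of_hexFace_eq_hexFace {i j : Fin 6} {c c' d d' : Fin 4} (hij : i ≠ j) (hcc' : c ≠ c')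
    (h : hexFace i c = hexFace j d) (h' : hexFace i c' = hexFace j d') : c = d' := by
  revert i j c c' d d'
  decide

namespace OctCorresponds

theorem exists_hexFace {f g : OctFace} {v w : OctVertex} (h : OctCorresponds f v g w) :
    ∃ i j c, v = hexVertex i ∧ w = hexVertex j ∧ f = hexFace i c ∧ g = hexFace j c := by
  induction h with
  | edge f g v w hfg hvw hfv hfw hgv hgw =>
    obtain ⟨i, rfl⟩ := hexVertex_surjective v
    obtain ⟨j, rfl⟩ := hexVertex_surjective w
    obtain ⟨c, rfl⟩ := has_hexVertex_iff.1 hfv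
    obtain ⟨c', rfl⟩ := has_hexVertex_iff.1 hgv
    obtain ⟨d, hd⟩ := has_hexVertex_iff.1 hfw
    obtain ⟨d', hd'⟩ := has_hexVertex_iff.1 hgw
    obtain rfl := eq_of_hexFace_eq_hexFace (ne_of_apply_ne _ hvw) (ne_of_apply_ne _ hfg)
      hd.symm hd'.symm
    exact ⟨i, j, c, rfl, rfl, rfl, hd'.symm⟩
  | opposite f v hfv =>
    obtain ⟨i, rfl⟩ := hexVertex_surjective v
    obtain ⟨c, rfl⟩ := has_hexVertex_iff.1 hfv
    exact ⟨i, i + 3, c, rfl, opp_hexVertex i, rfl, opp_hexFace i c⟩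
  | refl f v hfv =>
    obtain ⟨i, rfl⟩ := hexVertex_surjective v
    obtain ⟨c, rfl⟩ := has_hexVertex_iff.1 hfv
    exact ⟨i, i, c, rfl, rfl, rfl, rfl⟩
  | symm _ ih =>
    obtain ⟨i, j, c, hv, hw, hf, hg⟩ := ih
    exact ⟨j, i, c, hw, hv, hg, hf⟩
  | trans _ _ ih ih' =>
    obtain ⟨i, j, c, hu, hv, hf, hg⟩ := ih
    obtain ⟨j', k, c', hv', hw, hg', hh⟩ := ih'
    obtain rfl := hexVertex_injective (hv.symm.trans hv')
    obtain rfl := hexFace_injective j (hg.symm.trans hg')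
    exact ⟨i, k, c, hu, hw, hf, hh⟩

theorem hexFace_add_three (i : Fin 6) (c : Fin 4) :
    OctCorresponds (hexFace i c) (hexVertex i) (hexFace (i + 3) c) (hexVertex (i + 3)) :=
  opp_hexVertex i ▸ opp_hexFace i c ▸ .opposite _ _ (has_hexFace i c)

theorem hexFace_of_edge {i j : Fin 6} {c : Fin 4} (h : i ≠ j ∧ hexFace i c ≠ hexFace j c ∧
      (hexFace i c).Has (hexVertex j) ∧ (hexFace j c).Has (hexVertex i)) :
    OctCorresponds (hexFace i c) (hexVertex i) (hexFace j c) (hexVertex j) :=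
  .edge _ _ _ _ h.2.1 (hexVertex_injective.ne h.1) (has_hexFace i c) h.2.2.1 h.2.2.2
    (has_hexFace j c)

theorem hexFace_zero_one (c : Fin 4) :
    OctCorresponds (hexFace 0 c) (hexVertex 0) (hexFace 1 c) (hexVertex 1) := by
  fin_cases c
  exacts [hexFace_of_edge (by decide), hexFace_of_edge (by decide),
    (hexFace_add_three 0 2).trans (hexFace_of_edge (by decide)),
    (hexFace_add_three 0 3).trans (hexFace_of_edge (by decide))]

theorem hexFace_zero_five (c : Fin 4) :
    OctCorresponds (hexFace 0 c) (hexVertex 0) (hexFace 5 c) (hexVertex 5) := by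
  fin_cases c
  exacts [hexFace_of_edge (by decide),
    (hexFace_add_three 0 1).trans (hexFace_of_edge (by decide)),
    (hexFace_add_three 0 2).trans (hexFace_of_edge (by decide)), hexFace_of_edge (by decide)]

theorem hexFace_hexFace (i j : Fin 6) (c : Fin 4) :
    OctCorresponds (hexFace i c) (hexVertex i) (hexFace j c) (hexVertex j) := by
  have from_zero : ∀ k, OctCorresponds (hexFace 0 c) (hexVertex 0) (hexFace k c) (hexVertex k) := by
    intro k
    fin_cases k
    exacts [.refl _ _ (has_hexFace 0 c), hexFace_zero_one c,
      (hexFace_zero_five c).trans (hexFace_add_three 5 c), hexFace_add_three 0 c,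
      (hexFace_zero_one c).trans (hexFace_add_three 1 c), hexFace_zero_five c]
  exact (from_zero i).symm.trans (from_zero j)

end OctCorresponds

theorem octCorresponds_iff {f g : OctFace} {v w : OctVertex} : OctCorresponds f v g w ↔
    ∃ i j c, v = hexVertex i ∧ w = hexVertex j ∧ f = hexFace i c ∧ g = hexFace j c := by
  refine ⟨OctCorresponds.exists_hexFace, ?_⟩
  rintro ⟨i, j, c, rfl, rfl, rfl, rfl⟩
  exact .hexFace_hexFace i j c

end Combinatorics

/-! ## Generalized Clifford configurations -/

section Configuration

namespace OctahedralConfiguration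

open InnerProductGeometry

variable (K : OctahedralConfiguration)

/-- The points of a configuration in the order of the multi-ratios. -/
def hexPoint (i : Fin 6) : ℍ[ℝ] := K.point (hexVertex i)

theorem hexPoint_mem_carrier_iff {i : Fin 6} {f : OctFace} :
    K.hexPoint i ∈ (K.circle f).carrier ↔ f.Has (hexVertex i) :=
  K.mem_carrier_iff _ _

theorem hexPoint_injective : K.hexPoint.Injective := by
  intro i j h
  by_contra hij
  obtain ⟨c, hc⟩ := exists_hexFace_not_has hij
  rw [← K.hexPoint_mem_carrier_iff, ← h, K.hexPoint_mem_carrier_iff] at hc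
  exact hc (has_hexFace i c)

theorem traverses_hexFace (i : Fin 6) (c : Fin 4) : (K.circle (hexFace i c)).Traverses
    (K.hexPoint i) (K.hexPoint (hexNext i c).1) (K.hexPoint (hexNext i c).2) := by
  have traverses_vertex : ∀ (f : OctFace) (k : Fin 3), (K.circle f).Traverses
      (K.point (f.vertex k)) (K.point (f.vertex (k + 1))) (K.point (f.vertex (k + 2))) := by
    intro f k
    have h := K.traverses f
    fin_cases k
    exacts [h, h.rotate, h.rotate.rotate]
  obtain ⟨k, h₀, h₁, h₂⟩ := vertex_hexFace i c
  have h := traverses_vertex (hexFace i c) k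
  rwa [h₀, h₁, h₂] at h

theorem angleAt_hexPoint (i : Fin 6) (c d : Fin 4) :
    OrientedCircle.angleAt (K.hexPoint i) (K.circle (hexFace i c)) (K.circle (hexFace i d)) =
      angle (hexTangent K.hexPoint i c) (hexTangent K.hexPoint i d) := by
  obtain ⟨r, hr, hc⟩ := (K.traverses_hexFace i c).exists_tangent_eq_smul
  obtain ⟨s, hs, hd⟩ := (K.traverses_hexFace i d).exists_tangent_eq_smul
  rw [OrientedCircle.angleAt, hc, hd, angle_smul_left_of_pos _ _ hr,
    angle_smul_right_of_pos _ _ hs, angle_star_star, hexTangent, hexTangent]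

theorem isGeneralizedClifford_iff : K.IsGeneralizedClifford ↔
    ∀ i j, SameAngles (hexTangent K.hexPoint i) (hexTangent K.hexPoint j) := by
  refine ⟨fun h i j c d => ?_, fun h v w f g f' g' hf hg => ?_⟩
  · rw [← angleAt_hexPoint, ← angleAt_hexPoint]
    exact h _ _ _ _ _ _ (.hexFace_hexFace i j c) (.hexFace_hexFace i j d)
  · obtain ⟨i, j, c, rfl, rfl, rfl, rfl⟩ := octCorresponds_iff.1 hf
    obtain ⟨i', j', d, hi, hj, rfl, rfl⟩ := octCorresponds_iff.1 hg
    obtain rfl := hexVertex_injective hi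
    obtain rfl := hexVertex_injective hj
    exact (K.angleAt_hexPoint i c d).trans ((h i j c d).trans (K.angleAt_hexPoint j c d).symm)

theorem hexTangent_hexPoint_zero_two_ne_zero : hexTangent K.hexPoint 0 2 ≠ 0 :=
  invDiff_eq_zero_iff.not.2 (K.hexPoint_injective.ne (by decide))

theorem invDiff_ne_smul_hexTangent {k : Fin 6} (hk : ¬(hexFace 0 2).Has (hexVertex k)) (s : ℝ) :
    invDiff (K.hexPoint 0) (K.hexPoint 4) (K.hexPoint k) ≠ s • hexTangent K.hexPoint 0 2 :=
  fun h => hk <| K.hexPoint_mem_carrier_iff.1 <|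
    (K.traverses_hexFace 0 2).mem_carrier_of_invDiff_eq_smul h

theorem linearIndepOn_hexTangent_two_three :
    LinearIndepOn ℝ (hexTangent K.hexPoint 0) {2, 3} := by
  rw [linearIndepOn_pair_iff _ (by decide) K.hexTangent_hexPoint_zero_two_ne_zero]
  intro s hs
  refine K.invDiff_ne_smul_hexTangent (k := 5) (by decide) (-s) ?_
  rw [neg_smul, hs, invDiff_swap]
  rfl

theorem linearIndepOn_hexTangent_one_two :
    LinearIndepOn ℝ (hexTangent K.hexPoint 0) {1, 2} := by
  rw [Set.pair_comm, linearIndepOn_pair_iff _ (by decide) K.hexTangent_hexPoint_zero_two_ne_zero]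
  intro s hs
  refine K.invDiff_ne_smul_hexTangent (k := 1) (by decide) (1 + s) ?_
  rw [add_smul, one_smul, hs, ← invDiff_add_invDiff _ _ (K.hexPoint 2)]
  rfl

end OctahedralConfiguration

end Configuration

theorem mainTheorem1 :
    (∀ K : OctahedralConfiguration, K.IsGeneralizedClifford →
      rightMultiRatio (K.point .v14) (K.point .v12) (K.point .v24)
          (K.point .v23) (K.point .v34) (K.point .v13) = -1 ∨
        leftMultiRatio (K.point .v14) (K.point .v12) (K.point .v24)
          (K.point .v23) (K.point .v34) (K.point .v13) = -1) ∧
    (∀ K : OctahedralConfiguration,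
      (rightMultiRatio (K.point .v14) (K.point .v12) (K.point .v24)
          (K.point .v23) (K.point .v34) (K.point .v13) = -1 ∨
        leftMultiRatio (K.point .v14) (K.point .v12) (K.point .v24)
          (K.point .v23) (K.point .v34) (K.point .v13) = -1) →
      K.IsGeneralizedClifford) := by
  refine ⟨fun K hK => ?_, fun K hM => K.isGeneralizedClifford_iff.2 ?_⟩
  · have h := K.isGeneralizedClifford_iff.1 hK
    exact multiRatio_eq_neg_one_of_sameAngles (P := K.hexPoint) K.hexPoint_injective (h 0 1) (h 0 5)
      K.linearIndepOn_hexTangent_two_three K.linearIndepOn_hexTangent_one_two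
  · rcases hM with hM | hM
    · exact sameAngles_of_rightMultiRatio (P := K.hexPoint) K.hexPoint_injective hM
    · exact sameAngles_of_leftMultiRatio (P := K.hexPoint) K.hexPoint_injective hM
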